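/- For $s \in \mathbb{N}$ and binary vectors $x, y \in \{0,1\}^s$, let $x \vee y$ denote the coordinatewise disjunction, $|x|$ the Hamming weight (the number of coordinates equal to $1$), and $\vec 1^s$ the all-ones vector of length $s$. There are exactly $7^s$ triples $(x,y,z) \in (\{0,1\}^s)^3$ with $x \vee y \vee z = \vec 1^s$. Call such a triple a \emph{candidate} if in addition $$|x|,\ |y|,\ |z| \le \frac{4s}{7} \qquad\text{and}\qquad |x \vee y|,\ |x \vee z|,\ |y \vee z| \le \frac{6s}{7}.$$ Then there are $\Omega(7^s)$ candidates as $s \to \infty$; that is, there are a constant $c > 0$ and an $s_0$ such that for every $s \ge s_0$ the number of candidates is at least $c \cdot 7^s$. -/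

import Mathlib

open Filter

/-- Binary vectors of length `s`. -/
abbrev BinVec (s : ℕ) : Type := Fin s → Bool

namespace BinVec

/-- The coordinatewise disjunction of two binary vectors. -/
def disj {s : ℕ} (x y : BinVec s) : BinVec s := fun i => x i || y i

/-- The all-ones vector. -/
def ones (s : ℕ) : BinVec s := fun _ => true

/-- The Hamming weight, the number of coordinates equal to one. -/
def weight {s : ℕ} (x : BinVec s) : ℕ := (Finset.univ.filter fun i => x i = true).card

end BinVec

/-- The triples `(x, y, z)` of binary vectors whose disjunction is the all-ones vector. -/
def coveringTriples (s : ℕ) : Set (BinVec s × BinVec s × BinVec s) :=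
  {u | BinVec.disj (BinVec.disj u.1 u.2.1) u.2.2 = BinVec.ones s}

/-- A triple is a candidate if its disjunction is the all-ones vector, each vector has weight at
most `4s/7`, and each pairwise disjunction has weight at most `6s/7` (real division). -/
structure IsCandidate {s : ℕ} (x y z : BinVec s) : Prop where
  covers : (x, y, z) ∈ coveringTriples s
  weight_x : (x.weight : ℝ) ≤ 4 * (s : ℝ) / 7
  weight_y : (y.weight : ℝ) ≤ 4 * (s : ℝ) / 7
  weight_z : (z.weight : ℝ) ≤ 4 * (s : ℝ) / 7
  weight_xy : ((x.disj y).weight : ℝ) ≤ 6 * (s : ℝ) / 7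
  weight_xz : ((x.disj z).weight : ℝ) ≤ 6 * (s : ℝ) / 7
  weight_yz : ((y.disj z).weight : ℝ) ≤ 6 * (s : ℝ) / 7

/-- The set of candidates. -/
def candidates (s : ℕ) : Set (BinVec s × BinVec s × BinVec s) :=
  {u | IsCandidate u.1 u.2.1 u.2.2}

/-! Under the uniform law on covering triples the six weights have means exactly `4s/7` and `6s/7`,
so the bounds leave no slack. Instead, draw the coordinates independently from `tiltedWeight δ` with
`δ = 2/√s`, which lowers every mean by at least `δ * s`, a fixed multiple of the standard deviation.
Chebyshev (`sum_prod_weight_filter_lt_le`) and a union bound give the candidates mass at least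
`1/2`. The tilt has no first-order effect on the sum of squared masses (`sum_tiltedWeight_sq`),
which stays `O(7^(-s))`; Cauchy–Schwarz then turns mass into cardinality. -/

section ProductWeights

variable {τ : Type*} [Fintype τ]

/-- The total mass of a product weight is the power of the total mass of a factor. -/
lemma sum_prod_weight (p : τ → ℝ) (s : ℕ) :
    ∑ v : Fin s → τ, ∏ i, p (v i) = (∑ t, p t) ^ s := by
  classical
  simpa using (Fintype.sum_pow p s).symm

/-- The second moment of a shifted sum of independent centred variables. -/
lemma sum_prod_weight_mul_sq (p g : τ → ℝ) (hp : ∑ t, p t = 1) (hg : ∑ t, p t * g t = 0)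
    (s : ℕ) (c : ℝ) :
    ∑ v : Fin s → τ, (∏ i, p (v i)) * (c + ∑ i, g (v i)) ^ 2
      = c ^ 2 + s * ∑ t, p t * g t ^ 2 := by
  -- The value of the split-off coordinate is absorbed into the shift `c`.
  induction s generalizing c with
  | zero => simp
  | succ n ih =>
    rw [← (Fin.consEquiv fun _ : Fin (n + 1) => τ).sum_comp, Fintype.sum_prod_type]
    have h (t : τ) : ∑ v : Fin n → τ, (∏ i, p (Fin.consEquiv (fun _ => τ) (t, v) i)) *
        (c + ∑ i, g (Fin.consEquiv (fun _ => τ) (t, v) i)) ^ 2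
        = p t * ((c + g t) ^ 2 + n * ∑ t, p t * g t ^ 2) := by
      rw [← ih, Finset.mul_sum]
      refine Finset.sum_congr rfl fun v _ => ?_
      simp [Fin.consEquiv, Fin.prod_univ_succ, Fin.sum_univ_succ]
      ring
    simp only [h]
    have h' (t : τ) : p t * ((c + g t) ^ 2 + n * ∑ t, p t * g t ^ 2) =
        p t * (c ^ 2 + n * ∑ t, p t * g t ^ 2) + 2 * c * (p t * g t) + p t * g t ^ 2 := by ring
    simp only [h', Finset.sum_add_distrib, ← Finset.sum_mul, ← Finset.mul_sum, hp, hg]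
    push_cast
    ring

/-- Chebyshev's inequality for the number of coordinates satisfying a Boolean predicate. -/
lemma sum_prod_weight_filter_lt_le (p : τ → ℝ) (hp0 : ∀ t, 0 ≤ p t) (hp : ∑ t, p t = 1)
    (q : τ → Bool) {μ δ : ℝ} (hδ : 0 < δ) (hq : ∑ t, p t * (if q t then 1 else 0) ≤ μ - δ)
    {s : ℕ} (hs : 0 < s) :
    ∑ v : Fin s → τ with μ * s < BinVec.weight (fun i => q (v i)), ∏ i, p (v i)
      ≤ 1 / (4 * δ ^ 2 * s) := by
  set m : ℝ := ∑ t, p t * (if q t then 1 else 0) with hm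
  let g : τ → ℝ := fun t => (if q t then 1 else 0) - m
  have hg : ∑ t, p t * g t = 0 := by
    simp only [g, mul_sub, Finset.sum_sub_distrib, ← Finset.sum_mul, hp, ← hm]
    ring
  -- The variance of an indicator is `m * (1 - m)`.
  have hvar : ∑ t, p t * g t ^ 2 ≤ 1 / 4 := by
    have h (t : τ) : p t * g t ^ 2 =
        (1 - 2 * m) * (p t * (if q t then 1 else 0)) + p t * m ^ 2 := by
      by_cases hqt : q t <;> simp [g, hqt]
      ring
    simp only [h, Finset.sum_add_distrib, ← Finset.mul_sum, ← Finset.sum_mul, hp, ← hm]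
    nlinarith [sq_nonneg (m - 1 / 2)]
  have hs' : (0 : ℝ) < s := by exact_mod_cast hs
  have hW (v : Fin s → τ) : 0 ≤ ∏ i, p (v i) := Finset.prod_nonneg fun i _ => hp0 _
  have hsum (v : Fin s → τ) :
      ∑ i, g (v i) = (BinVec.weight (fun i => q (v i)) : ℝ) - s * m := by
    simp [g, BinVec.weight]
  have key := sum_prod_weight_mul_sq p g hp hg s 0
  have hle : (∑ v : Fin s → τ with μ * s < BinVec.weight (fun i => q (v i)), ∏ i, p (v i))
      * (δ * s) ^ 2 ≤ s * ∑ t, p t * g t ^ 2 := by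
    calc _ ≤ ∑ v : Fin s → τ with μ * s < BinVec.weight (fun i => q (v i)),
          (∏ i, p (v i)) * (0 + ∑ i, g (v i)) ^ 2 := by
          rw [Finset.sum_mul]
          refine Finset.sum_le_sum fun v hv => ?_
          have hv' := (Finset.mem_filter.mp hv).2
          refine mul_le_mul_of_nonneg_left ?_ (hW v)
          rw [hsum, zero_add]
          refine pow_le_pow_left₀ (by positivity) ?_ 2
          nlinarith
      _ ≤ ∑ v : Fin s → τ, (∏ i, p (v i)) * (0 + ∑ i, g (v i)) ^ 2 :=
          Finset.sum_le_sum_of_subset_of_nonneg (Finset.filter_subset _ _)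
            fun v _ _ => mul_nonneg (hW v) (sq_nonneg _)
      _ = _ := by rw [key]; ring
  rw [le_div_iff₀ (by positivity)]
  refine le_of_mul_le_mul_right ?_ hs'
  nlinarith

end ProductWeights

/-- The triple of binary vectors whose coordinates are listed by `v`. -/
def BinVec.unzip {s : ℕ} (v : Fin s → Bool × Bool × Bool) : BinVec s × BinVec s × BinVec s :=
  (fun i => (v i).1, fun i => (v i).2.1, fun i => (v i).2.2)

lemma BinVec.unzip_bijective (s : ℕ) : Function.Bijective (BinVec.unzip (s := s)) := by
  constructor
  · intro v w h
    simp only [BinVec.unzip, Prod.mk.injEq] at h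
    funext i
    exact Prod.ext (congrFun h.1 i) (Prod.ext (congrFun h.2.1 i) (congrFun h.2.2 i))
  · rintro ⟨x, y, z⟩
    exact ⟨fun i => (x i, y i, z i), rfl⟩

lemma BinVec.ncard_preimage_unzip {s : ℕ} (A : Set (BinVec s × BinVec s × BinVec s)) :
    (BinVec.unzip ⁻¹' A).ncard = A.ncard :=
  Set.ncard_preimage_of_injective_subset_range (BinVec.unzip_bijective s).1
    ((BinVec.unzip_bijective s).2.range_eq ▸ Set.subset_univ _)

lemma unzip_mem_coveringTriples {s : ℕ} (v : Fin s → Bool × Bool × Bool) :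
    BinVec.unzip v ∈ coveringTriples s ↔ ∀ i, v i ≠ (false, false, false) := by
  simp only [coveringTriples, BinVec.unzip, BinVec.disj, BinVec.ones, Set.mem_ofPred_eq,
    funext_iff]
  refine forall_congr' fun i => ?_
  rcases v i with ⟨_ | _, _ | _, _ | _⟩ <;> simp

lemma ncard_coveringTriples (s : ℕ) : (coveringTriples s).ncard = 7 ^ s := by
  rw [← BinVec.ncard_preimage_unzip]
  have h : BinVec.unzip ⁻¹' coveringTriples s =
      ((Fintype.piFinset fun _ : Fin s =>
        (Finset.univ.erase (false, false, false) : Finset (Bool × Bool × Bool)) :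
          Finset (Fin s → Bool × Bool × Bool)) : Set (Fin s → Bool × Bool × Bool)) := by
    ext v
    simp [unzip_mem_coveringTriples]
  rw [h, Set.ncard_coe_finset, Fintype.card_piFinset_const]
  rfl

/-- A perturbation of the uniform distribution on the seven nonzero elements of `{0,1}³`, which
favours the elements of weight one over the all-ones element. -/
noncomputable def tiltedWeight (δ : ℝ) : Bool × Bool × Bool → ℝ
  | (false, false, false) => 0
  | (true, false, false) => 1 / 7 + δ
  | (false, true, false) => 1 / 7 + δ
  | (false, false, true) => 1 / 7 + δ
  | (true, true, false) => 1 / 7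
  | (true, false, true) => 1 / 7
  | (false, true, true) => 1 / 7
  | (true, true, true) => 1 / 7 - 3 * δ

lemma tiltedWeight_nonneg {δ : ℝ} (h0 : 0 ≤ δ) (h1 : δ ≤ 1 / 21) (t : Bool × Bool × Bool) :
    0 ≤ tiltedWeight δ t := by
  rcases t with ⟨_ | _, _ | _, _ | _⟩ <;> simp only [tiltedWeight] <;> linarith

lemma sum_tiltedWeight (δ : ℝ) : ∑ t, tiltedWeight δ t = 1 := by
  simp only [Fintype.sum_prod_type, Fintype.sum_bool, tiltedWeight]
  ring

/-- The perturbation of the uniform law sums to zero, so the terms linear in `δ` cancel. -/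
lemma sum_tiltedWeight_sq (δ : ℝ) : ∑ t, tiltedWeight δ t ^ 2 = 1 / 7 + 12 * δ ^ 2 := by
  simp only [Fintype.sum_prod_type, Fintype.sum_bool, tiltedWeight]
  ring

/-- The tilted product weight gives the candidates at least half of its mass. -/
lemma half_le_sum_tiltedWeight_candidates {s : ℕ} (hs : 0 < s) {δ : ℝ} (h0 : 0 < δ)
    (h1 : δ ≤ 1 / 21) (hδ : δ ^ 2 * s = 4) [DecidablePred (BinVec.unzip · ∈ candidates s)] :
    1 / 2 ≤ ∑ v : Fin s → Bool × Bool × Bool with BinVec.unzip v ∈ candidates s,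
      ∏ i, tiltedWeight δ (v i) := by
  classical
  set W : (Fin s → Bool × Bool × Bool) → ℝ := fun v => ∏ i, tiltedWeight δ (v i)
  have hW (v) : 0 ≤ W v := Finset.prod_nonneg fun i _ => tiltedWeight_nonneg h0.le h1 _
  have htot : ∑ v, W v = 1 := by simp [W, sum_prod_weight, sum_tiltedWeight]
  let E (μ : ℝ) (q : Bool × Bool × Bool → Bool) : Finset (Fin s → Bool × Bool × Bool) :=
    Finset.univ.filter fun v => μ * s < BinVec.weight (fun i => q (v i))
  have hE (μ : ℝ) (q : Bool × Bool × Bool → Bool)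
      (hq : ∑ t, tiltedWeight δ t * (if q t then 1 else 0) ≤ μ - δ) :
      ∑ v, (if v ∈ E μ q then W v else 0) ≤ 1 / 16 := by
    rw [← Finset.sum_filter]
    simp only [Finset.filter_univ_mem]
    refine (sum_prod_weight_filter_lt_le _ (tiltedWeight_nonneg h0.le h1) (sum_tiltedWeight δ)
      q h0 hq hs).trans (le_of_eq ?_)
    rw [mul_assoc, hδ]
    norm_num
  -- The tilted means are `4/7 - 2δ` for single vectors and exactly `6/7 - δ` for pairs.
  have hx := hE (4 / 7) (fun t => t.1) (by
    simp [Fintype.sum_prod_type, tiltedWeight]; linarith)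
  have hy := hE (4 / 7) (fun t => t.2.1) (by
    simp [Fintype.sum_prod_type, tiltedWeight]; linarith)
  have hz := hE (4 / 7) (fun t => t.2.2) (by
    simp [Fintype.sum_prod_type, tiltedWeight]; linarith)
  have hxy := hE (6 / 7) (fun t => t.1 || t.2.1) (by
    simp [Fintype.sum_prod_type, tiltedWeight]; linarith)
  have hxz := hE (6 / 7) (fun t => t.1 || t.2.2) (by
    simp [Fintype.sum_prod_type, tiltedWeight]; linarith)
  have hyz := hE (6 / 7) (fun t => t.2.1 || t.2.2) (by
    simp [Fintype.sum_prod_type, tiltedWeight]; linarith)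
  -- Pointwise union bound; a non-covering `v` has mass zero, so it needs no term of its own.
  have hpt (v : Fin s → Bool × Bool × Bool) :
      W v ≤ (if BinVec.unzip v ∈ candidates s then W v else 0)
        + (if v ∈ E (4 / 7) (fun t => t.1) then W v else 0)
        + (if v ∈ E (4 / 7) (fun t => t.2.1) then W v else 0)
        + (if v ∈ E (4 / 7) (fun t => t.2.2) then W v else 0)
        + (if v ∈ E (6 / 7) (fun t => t.1 || t.2.1) then W v else 0)
        + (if v ∈ E (6 / 7) (fun t => t.1 || t.2.2) then W v else 0)
        + (if v ∈ E (6 / 7) (fun t => t.2.1 || t.2.2) then W v else 0) := by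
    have hn (P : Prop) [Decidable P] : 0 ≤ if P then W v else 0 := by
      split_ifs
      exacts [hW v, le_rfl]
    by_cases hc : BinVec.unzip v ∈ coveringTriples s
    · by_contra! hlt
      have hmem (P : Prop) [Decidable P] (h : (if P then W v else 0) < W v) : ¬P :=
        fun hP => by simp [hP] at h
      have a0 := hn (BinVec.unzip v ∈ candidates s)
      have a1 := hn (v ∈ E (4 / 7) (fun t => t.1))
      have a2 := hn (v ∈ E (4 / 7) (fun t => t.2.1))
      have a3 := hn (v ∈ E (4 / 7) (fun t => t.2.2))
      have a4 := hn (v ∈ E (6 / 7) (fun t => t.1 || t.2.1))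
      have a5 := hn (v ∈ E (6 / 7) (fun t => t.1 || t.2.2))
      have a6 := hn (v ∈ E (6 / 7) (fun t => t.2.1 || t.2.2))
      have hle {μ : ℝ} {q : Bool × Bool × Bool → Bool}
          (h : (if v ∈ E μ q then W v else 0) < W v) :
          (BinVec.weight (fun i => q (v i)) : ℝ) ≤ μ * s := by
        simpa [E] using hmem _ h
      refine hmem (BinVec.unzip v ∈ candidates s) (by linarith) ⟨hc, ?_, ?_, ?_, ?_, ?_, ?_⟩ <;>
        rw [mul_div_right_comm]
      · exact hle (q := fun t => t.1) (by linarith)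
      · exact hle (q := fun t => t.2.1) (by linarith)
      · exact hle (q := fun t => t.2.2) (by linarith)
      · exact hle (q := fun t => t.1 || t.2.1) (by linarith)
      · exact hle (q := fun t => t.1 || t.2.2) (by linarith)
      · exact hle (q := fun t => t.2.1 || t.2.2) (by linarith)
    · have hz : W v = 0 := by
        rw [unzip_mem_coveringTriples] at hc
        push Not at hc
        obtain ⟨i, hi⟩ := hc
        exact Finset.prod_eq_zero (Finset.mem_univ i) (by rw [hi]; rfl)
      simp [hz]
  have hfin := Finset.sum_le_sum fun v (_ : v ∈ Finset.univ) => hpt v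
  simp only [Finset.sum_add_distrib, htot] at hfin
  rw [← Finset.sum_filter] at hfin
  -- The six failure events cost at most `6/16 < 1/2`.
  linarith

theorem mainTheorem10 :
    (∀ s : ℕ, (coveringTriples s).ncard = 7 ^ s) ∧
      ∃ c : ℝ, 0 < c ∧ ∀ᶠ s : ℕ in atTop, c * (7 : ℝ) ^ s ≤ ((candidates s).ncard : ℝ) := by
  classical
  refine ⟨ncard_coveringTriples, Real.exp (-336) / 4, by positivity, ?_⟩
  -- `1764 = 42 ^ 2` makes `δ ≤ 1/21`, which keeps the mass `1/7 - 3δ` nonnegative.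
  filter_upwards [eventually_ge_atTop 1764] with s hs
  have hs' : (1764 : ℝ) ≤ s := by exact_mod_cast hs
  have hs0 : (0 : ℝ) < s := by linarith
  have hsqrt : 42 ≤ √(s : ℝ) := Real.le_sqrt_of_sq_le (by linarith)
  set δ : ℝ := 2 / √(s : ℝ) with hδ
  have h0 : 0 < δ := by positivity
  have h1 : δ ≤ 1 / 21 := by
    rw [hδ, div_le_div_iff₀ (by linarith) (by norm_num)]
    linarith
  have hδs : δ ^ 2 * s = 4 := by
    rw [hδ, div_pow, Real.sq_sqrt hs0.le]
    field_simp
    norm_num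
  have hhalf := half_le_sum_tiltedWeight_candidates (by omega) h0 h1 hδs
  set A : Finset (Fin s → Bool × Bool × Bool) :=
    Finset.univ.filter fun v => BinVec.unzip v ∈ candidates s with hA
  have hcard : ((candidates s).ncard : ℝ) = A.card := by
    rw [← BinVec.ncard_preimage_unzip, ← Set.ncard_coe_finset]
    congr 2
    ext v
    simp [hA]
  -- Cauchy–Schwarz: mass `1/2` with a small sum of squares forces `A` to be large.
  have hcs := sq_sum_le_card_mul_sum_sq (s := A) (f := fun v => ∏ i, tiltedWeight δ (v i))
  have hsq : ∑ v ∈ A, (∏ i, tiltedWeight δ (v i)) ^ 2 ≤ Real.exp 336 / 7 ^ s := by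
    calc _ ≤ ∑ v : Fin s → Bool × Bool × Bool, (∏ i, tiltedWeight δ (v i)) ^ 2 :=
          Finset.sum_le_sum_of_subset_of_nonneg (Finset.subset_univ _) fun v _ _ => sq_nonneg _
      _ = (1 / 7 + 12 * δ ^ 2) ^ s := by
          simp only [← Finset.prod_pow]
          rw [sum_prod_weight (fun t => tiltedWeight δ t ^ 2), sum_tiltedWeight_sq]
      _ = (1 + 84 * δ ^ 2) ^ s / 7 ^ s := by
          rw [← div_pow]
          ring
      _ ≤ Real.exp (84 * δ ^ 2) ^ s / 7 ^ s := by
          gcongr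
          linarith [Real.add_one_le_exp (84 * δ ^ 2)]
      -- `336 = 84 * 4`, from `δ ^ 2 * s = 4`.
      _ = Real.exp 336 / 7 ^ s := by
          rw [← Real.exp_nat_mul]
          congr 2
          linarith
  have hquarter : 1 / 4 ≤ (A.card : ℝ) * (Real.exp 336 / 7 ^ s) := by
    refine le_trans ?_ (hcs.trans (mul_le_mul_of_nonneg_left hsq (Nat.cast_nonneg _)))
    nlinarith
  rw [hcard, Real.exp_neg]
  have he := Real.exp_pos 336
  have h7 : (0 : ℝ) < 7 ^ s := by positivity
  calc (Real.exp 336)⁻¹ / 4 * 7 ^ s = 1 / 4 * (7 ^ s / Real.exp 336) := by field_simp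
    _ ≤ A.card * (Real.exp 336 / 7 ^ s) * (7 ^ s / Real.exp 336) := by gcongr
    _ = A.card := by field_simp
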